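/- Let $(\mathsf Z,\mathscr Z)$ be a measurable space, $\nu$ a measure and $\pi$ a probability measure on it such that $\pi$ has a Radon--Nikodym derivative $\varpi=\mathrm d\pi/\mathrm d\nu:\mathsf Z\to[0,\infty)$, i.e. $\varpi$ is measurable and $\pi(A)=\int_A\varpi\,\mathrm d\nu$ for all $A\in\mathscr Z$. Let $Q,Q^*$ be Markov kernels on $\mathsf Z$ such that $(\nu,Q,Q^*)$ is a reversible triplet, i.e. $\nu(\mathrm dz)Q(z,\mathrm dz')=\nu(\mathrm dz')Q^*(z',\mathrm dz)$, meaning $\int_A\nu(\mathrm dz)Q(z,B)=\int_B\nu(\mathrm dz')Q^*(z',A)$ for all $A,B\in\mathscr Z$. For $k\in\mathbb Z$ let $\Lambda^k$ be the law on $\mathsf Z^{\mathbb Z}$ of the two-sided Markov chain $\mathtt Z=(z_i)_{i\in\mathbb Z}$ with $z_k\sim\pi$, forward transitions $z_{k+i}\mid z_{k+i-1}=z\sim Q(z,\cdot)$ and backward transitions $z_{k-i}\mid z_{k-i+1}=z\sim Q^*(z,\cdot)$ for $i\ge1$ (future and past being independent given $z_k$). Let $\mathcal Q(z_0,\cdot)$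 be the law of $\mathtt Z\sim\Lambda^0$ conditional on $z_0$, and $\theta^k(\mathtt Z)_j=z_{k+j}$. For a measure $\mu$ and a measurable set $S$ write $\mu_S=\mu(\cdot\cap S)$, and $\mu^\phi$ for the image of $\mu$ under $\phi$. (1) For every $k\in\mathbb Z$, with $S_k=\{\mathtt Z:\varpi(z_0)\wedge\varpi(z_k)>0\}$, the measures $\Lambda^k_{S_k}$ and $\Lambda^0_{S_k}$ are equivalent (each is absolutely continuous with respect to the other) and $$\frac{\mathrm d\Lambda^k_{S_k}}{\mathrm d\Lambda^0_{S_k}}(\mathtt Z)=\frac{\varpi(z_k)}{\varpi(z_0)},\qquad \mathtt Z\in S_k.$$ (2) Let $\varsigma(\cdot;\mathtt Z)$ be a probability distribution on $\mathbb Z$ depending measurably on $\mathtt Z\in\mathsf Z^{\mathbb Z}$, and put $\mu(\mathrm d\mathtt Z,k)=\Lambda^0(\mathrm d\mathtt Z)\varsigma(k;\mathtt Z)$, $\phi(\mathtt Z,k)=(\theta^k(\mathtt Z),-k)$ and $S=\{(\mathtt Z,k):\varpi(z_0)\wedge\varpi(z_k)\wedge\varsigma(k;\mathtt Z)\wedge\varsigma(-k;\theta^k(\mathtt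 Z))>0\}$. Then $\phi$ is an involution, $\phi(S)=S$, $\mu$ and $\mu^\phi$ are mutually singular on $S^\complement$, $\mu_S$ and $\mu_S^\phi:=(\mu_S)^\phi$ are equivalent, and $$\frac{\mathrm d\mu_S^\phi}{\mathrm d\mu_S}(\mathtt Z,k)=r(\mathtt Z,k):=\frac{\varpi(z_k)\,\varsigma(-k;\theta^k(\mathtt Z))}{\varpi(z_0)\,\varsigma(k;\mathtt Z)}\quad\text{for }(\mathtt Z,k)\in S .$$ (3) Set $r=0$ outside $S$, and let $a:[0,\infty)\to[0,1]$ be any measurable function with $a(0)=0$ and $a(r)=r\,a(1/r)$ for $r>0$. The kernel $\Pi$ on $\mathsf Z^{\mathbb Z}\times\mathbb Z$ that moves from $\xi$ to $\phi(\xi)$ with probability $a(r(\xi))$ and otherwise stays at $\xi$ is a $\mu$-reversible Markov kernel. The Markov chain proposal kernel $P$ on $\mathsf Z$, which from $z_0$ draws $\mathtt Z\sim\mathcal Q(z_0,\cdot)$, then $k\sim\varsigma(\cdot;\mathtt Z)$, and outputs $z_k$ with probability $a(r(\mathtt Z,k))$ and $z_0$ otherwise, is a $\pi$-reversible Markov kernel.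 -/

import Mathlib

open MeasureTheory ProbabilityTheory
open scoped NNReal ENNReal

namespace MarkovProposal

/-! ### Radon–Nikodym derivatives and reversible triplets -/

/-- `f` is a version of the Radon–Nikodym derivative `dμ/dν`: it is a measurable function with
values in `[0, ∞)` and `μ(A) = ∫_A f dν` for every measurable set `A`. -/
def HasRNDeriv {E : Type*} [MeasurableSpace E] (μ ν : Measure E) (f : E → ℝ≥0) : Prop :=
  Measurable f ∧ ∀ A : Set E, MeasurableSet A → μ A = ∫⁻ x in A, (f x : ℝ≥0∞) ∂ν

/-- `(ν, Q, Q*)` is a reversible triplet: `ν(dz) Q(z, dz') = ν(dz') Q*(z', dz)`, that is, the two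
sides give the same mass to every measurable rectangle `A × B`. -/
def IsReversibleTriplet {Z : Type*} [MeasurableSpace Z] (ν : Measure Z) (Q Qs : Kernel Z Z) :
    Prop :=
  ∀ A B : Set Z, MeasurableSet A → MeasurableSet B →
    ∫⁻ z in A, Q z B ∂ν = ∫⁻ z' in B, Qs z' A ∂ν

/-! ### The two-sided Markov chain -/

section Chain

variable {Z : Type*} [MeasurableSpace Z]

/-- The law of the one-sided Markov chain `(z₀, z₁, z₂, …)` with transition kernel `Q`, as a
function of its starting point `z₀`. -/
noncomputable def chainFrom (Q : Kernel Z Z) [IsMarkovKernel Q] : Kernel Z (ℕ → Z) :=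
  (Kernel.traj (X := fun _ : ℕ => Z)
    (fun n => Q.comap (fun x : (i : Finset.Iic n) → Z => x ⟨n, Finset.mem_Iic.2 le_rfl⟩)
      (measurable_pi_apply _)) 0).comap
    (fun z (_ : Finset.Iic 0) => z) (measurable_pi_lambda _ fun _ => measurable_id)

/-- Glue two one-sided sequences into a two-sided one: `f` is read forwards from position `k` on,
and `b` backwards from position `k`, so that `z_{k+n} = f n` for `n ≥ 0` and `z_{k-n} = b n` for
`n ≥ 1`. -/
def glue (k : ℤ) (p : (ℕ → Z) × (ℕ → Z)) : ℤ → Z :=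
  fun i => if k ≤ i then p.1 (i - k).toNat else p.2 (k - i).toNat

instance (Q : Kernel Z Z) [IsMarkovKernel Q] : IsMarkovKernel (chainFrom Q) := by
  unfold chainFrom
  infer_instance

lemma measurable_glue (k : ℤ) : Measurable (glue (Z := Z) k) := by
  refine measurable_pi_lambda _ fun i => ?_
  by_cases h : k ≤ i
  · simp only [glue, h, if_true]
    fun_prop
  · simp only [glue, h, if_false]
    fun_prop

/-- The law of the two-sided Markov chain conditional on `Z_k = z`: forward transitions follow `Q`,
backward transitions follow `Q*`, and future and past are independent given `Z_k = z`. For `k = 0`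
this is the conditional law `𝒬(z₀, ·)`. -/
noncomputable def twoSidedFrom (k : ℤ) (Q Qs : Kernel Z Z) [IsMarkovKernel Q]
    [IsMarkovKernel Qs] : Kernel Z (ℤ → Z) :=
  (chainFrom Q ×ₖ chainFrom Qs).map (glue k)

instance (k : ℤ) (Q Qs : Kernel Z Z) [IsMarkovKernel Q] [IsMarkovKernel Qs] :
    IsMarkovKernel (twoSidedFrom k Q Qs) :=
  Kernel.IsMarkovKernel.map _ (measurable_glue k)

/-- The two-sided `(k, π, Q, Q*)`-Markov chain probability measure `Λ^k`. -/
noncomputable def twoSidedChain (k : ℤ) (pi : Measure Z) (Q Qs : Kernel Z Z) [IsMarkovKernel Q]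
    [IsMarkovKernel Qs] : Measure (ℤ → Z) :=
  pi.bind (twoSidedFrom k Q Qs)

instance (k : ℤ) (pi : Measure Z) [IsProbabilityMeasure pi] (Q Qs : Kernel Z Z)
    [IsMarkovKernel Q] [IsMarkovKernel Qs] : IsProbabilityMeasure (twoSidedChain k pi Q Qs) := by
  unfold twoSidedChain
  infer_instance

/-- The set `S_k` of sequences with `ϖ(z₀) ∧ ϖ(z_k) > 0`. -/
def posSet (w : Z → ℝ≥0) (k : ℤ) : Set (ℤ → Z) :=
  {x | 0 < min (w (x 0)) (w (x k))}

/-- The shift `θ^k`, with `θ^k(x)_j = x_{k+j}`. -/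
def shift (k : ℤ) (x : ℤ → Z) : ℤ → Z := fun j => x (k + j)

end Chain

/-! ### The Metropolis–Hastings kernel with a Markov chain proposal -/

/-- An acceptance function `a : [0, ∞) → [0, 1]`: it is measurable, `a(0) = 0` and
`a(r) = r a(1/r)` for `r > 0`. -/
structure IsAcceptanceFun (a : ℝ≥0 → ℝ≥0) : Prop where
  measurable : Measurable a
  le_one : ∀ r, a r ≤ 1
  zero : a 0 = 0
  eq_mul : ∀ r, 0 < r → a r = r * a (1 / r)

/-- The kernel which, from `ξ`, moves to `φ ξ` with probability `α ξ` and otherwise stays at `ξ`. -/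
noncomputable def acceptReject {E : Type*} [MeasurableSpace E] (φ : E → E) (hφ : Measurable φ)
    (α : E → ℝ≥0) (hα : Measurable α) : Kernel E E where
  toFun ξ := α ξ • Measure.dirac (φ ξ) + (1 - α ξ) • Measure.dirac ξ
  measurable' := by
    refine Measure.measurable_of_measurable_coe _ fun s hs => ?_
    have h1 : Measurable fun ξ => (Measure.dirac (φ ξ) : Measure E) s :=
      (Measure.measurable_coe hs).comp (Measure.measurable_dirac.comp hφ)
    have h2 : Measurable fun ξ => (Measure.dirac ξ : Measure E) s :=
      (Measure.measurable_coe hs).comp Measure.measurable_dirac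
    have h3 : Measurable fun ξ => (α ξ : ℝ≥0∞) := measurable_coe_nnreal_ennreal.comp hα
    have h4 : Measurable fun ξ => ((1 - α ξ : ℝ≥0) : ℝ≥0∞) :=
      measurable_coe_nnreal_ennreal.comp (measurable_const.sub hα)
    exact (h3.mul h1).add (h4.mul h2)

section Proposal

variable {Z : Type*} [MeasurableSpace Z]

/-- The probability `ς(k; x)` of the proposal index `k` given the sequence `x`. -/
noncomputable def idxProb (s : Kernel (ℤ → Z) ℤ) (k : ℤ) (x : ℤ → Z) : ℝ≥0 :=
  (s x {k}).toNNReal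

/-- The law `μ(dx, k) = Λ⁰(dx) ς(k; x)` of a sequence together with a proposal index. -/
noncomputable def extendedLaw (pi : Measure Z) (Q Qs : Kernel Z Z) [IsMarkovKernel Q]
    [IsMarkovKernel Qs] (s : Kernel (ℤ → Z) ℤ) : Measure ((ℤ → Z) × ℤ) :=
  (twoSidedChain 0 pi Q Qs).compProd s

/-- The involution `φ(x, k) = (θ^k(x), -k)`. -/
def invo (ξ : (ℤ → Z) × ℤ) : (ℤ → Z) × ℤ := (shift ξ.2 ξ.1, -ξ.2)

/-- The set `S` of pairs with `ϖ(z₀) ∧ ϖ(z_k) ∧ ς(k; x) ∧ ς(-k; θ^k(x)) > 0`. -/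
def extendedSet (w : Z → ℝ≥0) (s : Kernel (ℤ → Z) ℤ) : Set ((ℤ → Z) × ℤ) :=
  {ξ | 0 < min (min (w (ξ.1 0)) (w (ξ.1 ξ.2)))
    (min (idxProb s ξ.2 ξ.1) (idxProb s (-ξ.2) (shift ξ.2 ξ.1)))}

/-- The acceptance ratio `ϖ(z_k) ς(-k; θ^k(x)) / (ϖ(z₀) ς(k; x))` on `S`, and `0` outside `S`. -/
noncomputable def acceptRatio (w : Z → ℝ≥0) (s : Kernel (ℤ → Z) ℤ) : (ℤ → Z) × ℤ → ℝ≥0 :=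
  (extendedSet w s).indicator fun ξ =>
    (w (ξ.1 ξ.2) * idxProb s (-ξ.2) (shift ξ.2 ξ.1)) / (w (ξ.1 0) * idxProb s ξ.2 ξ.1)

lemma measurable_shift (k : ℤ) : Measurable (shift (Z := Z) k) :=
  measurable_pi_lambda _ fun _ => measurable_pi_apply _

lemma measurable_invo : Measurable (invo (Z := Z)) :=
  measurable_from_prod_countable_left fun k =>
    (measurable_shift k).prodMk (measurable_const (a := -k))

lemma measurable_idxProb (s : Kernel (ℤ → Z) ℤ) (k : ℤ) : Measurable (idxProb s k) :=
  (s.measurable_coe (measurableSet_singleton k)).ennreal_toNNReal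

lemma measurableSet_extendedSet {w : Z → ℝ≥0} (hw : Measurable w) (s : Kernel (ℤ → Z) ℤ) :
    MeasurableSet (extendedSet w s) := by
  have h : Measurable fun ξ : (ℤ → Z) × ℤ => min (min (w (ξ.1 0)) (w (ξ.1 ξ.2)))
      (min (idxProb s ξ.2 ξ.1) (idxProb s (-ξ.2) (shift ξ.2 ξ.1))) :=
    measurable_from_prod_countable_left fun k =>
      ((hw.comp (measurable_pi_apply _)).min (hw.comp (measurable_pi_apply _))).min
        ((measurable_idxProb s k).min ((measurable_idxProb s (-k)).comp (measurable_shift k)))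
  exact measurableSet_lt measurable_const h

lemma measurable_acceptRatio {w : Z → ℝ≥0} (hw : Measurable w) (s : Kernel (ℤ → Z) ℤ) :
    Measurable (acceptRatio w s) := by
  refine Measurable.indicator ?_ (measurableSet_extendedSet hw s)
  exact measurable_from_prod_countable_left fun k =>
    ((hw.comp (measurable_pi_apply _)).mul
      ((measurable_idxProb s (-k)).comp (measurable_shift k))).div
      ((hw.comp (measurable_pi_apply _)).mul (measurable_idxProb s k))

/-- The accept-reject kernel on pairs `ξ = (x, k)`: it moves from `ξ` to `φ(ξ)` with probability
`a(r(ξ))`, where `r` is the acceptance ratio, and otherwise stays at `ξ`. -/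
noncomputable def pairKernel {w : Z → ℝ≥0} (hw : Measurable w) (s : Kernel (ℤ → Z) ℤ)
    {a : ℝ≥0 → ℝ≥0} (ha : IsAcceptanceFun a) : Kernel ((ℤ → Z) × ℤ) ((ℤ → Z) × ℤ) :=
  acceptReject invo measurable_invo (fun ξ => a (acceptRatio w s ξ))
    (ha.measurable.comp (measurable_acceptRatio hw s))

/-- The Markov chain proposal kernel: from `z₀`, draw a two-sided chain `x` from `𝒬(z₀, ·)`, then an
index `k` from `ς(·; x)`, and apply the accept-reject step to `(x, k)`; the output is the
coordinate at `0` of the resulting sequence, which is `z_k` on acceptance (as `θ^k(x)_0 = z_k`) and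
`z₀` on rejection. -/
noncomputable def mcProposalKernel (Q Qs : Kernel Z Z) [IsMarkovKernel Q] [IsMarkovKernel Qs]
    {w : Z → ℝ≥0} (hw : Measurable w) (s : Kernel (ℤ → Z) ℤ)
    {a : ℝ≥0 → ℝ≥0} (ha : IsAcceptanceFun a) : Kernel Z Z :=
  ((pairKernel hw s ha) ∘ₖ ((twoSidedFrom 0 Q Qs) ⊗ₖ (Kernel.prodMkLeft Z s))).map
    (fun ξ => ξ.1 0)

end Proposal

end MarkovProposal

open MarkovProposal

/-!
The two-sided chain started from the reference measure `ν` instead of `π` does not depend on the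
time `k` at which it is started: going from base point `k` to base point `k + 1` replaces one
forward transition `ν(dz) Q(z, dz')` by one backward transition `ν(dz') Q*(z', dz)`, and these agree
by reversibility (`twoSidedChain_add_one`, `twoSidedChain_eq_zero`). Call this common measure `Λ`;
it is invariant under shifts (`map_shift_twoSidedChain`). Since `π` has density `ϖ` with respect to
`ν`, the law `Λ^k` has density `ϖ(z_k)` with respect to `Λ` (`twoSidedChain_withDensity`), which
gives the change of measure between `Λ^k` and `Λ^0`.

The extended law has density `m(x, k) = ϖ(z₀) ς(k; x)` with respect to the product of `Λ` with the
counting measure on `ℤ` (`extendedLaw_eq_withDensity`). The involution `φ` preserves that product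
(`map_invo_indexedMeasure`), so the image of the extended law has density `m ∘ φ`, the set `S` is
`{m > 0, m ∘ φ > 0}`, and the acceptance ratio is `(m ∘ φ) / m`. The claims on singularity and
densities are then statements about two densities, and detailed balance for the accept-reject
kernel is the identity `a(y / x) x = a(x / y) y` (`acceptReject_isReversible`,
`acceptance_mul_pairWeight_invo`). Reversibility passes to the kernel on `Z` because `z₀ ∼ π` under
the extended law (`setLIntegral_mcProposalKernel`).

Two points need care. The one-sided chain is defined by the Ionescu-Tulcea theorem, which adds
transitions at the end, while the change of base point needs the first transition to be split off
(`chainFrom_eq_bind`). And `ν` is an arbitrary measure, while the identity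
`ν(dz) Q(z, dz') = ν(dz') Q*(z', dz)` is only assumed on rectangles and extends to the product
`σ`-algebra for `σ`-finite `ν`; `exists_sigmaFinite_reference` replaces `ν` by its restriction to
the states within finitely many forward or backward steps of `{ϖ > 0}`, on which it is
`σ`-finite.
-/

namespace MarkovProposal

/-! ### First-step decomposition of the one-sided chain -/

section Chain

variable {Z : Type*} [MeasurableSpace Z]

/-- The sequence `z, x₀, x₁, …` obtained by prepending `z` to `x`. -/
def consSeq (z : Z) (x : ℕ → Z) : ℕ → Z
  | 0 => z
  | n + 1 => x n

lemma measurable_consSeq : Measurable fun p : Z × (ℕ → Z) => consSeq p.1 p.2 := by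
  refine measurable_pi_lambda _ fun n => ?_
  cases n with
  | zero => exact measurable_fst
  | succ n => exact (measurable_pi_apply n).comp measurable_snd

lemma measurable_consSeq_right (z : Z) : Measurable (consSeq z) :=
  measurable_consSeq.comp measurable_prodMk_left

lemma chainFrom_apply (Q : Kernel Z Z) [IsMarkovKernel Q] (z : Z) :
    chainFrom Q z = Kernel.traj (X := fun _ : ℕ => Z)
      (fun n => Q.comap (fun x : (i : Finset.Iic n) → Z => x ⟨n, Finset.mem_Iic.2 le_rfl⟩)
        (measurable_pi_apply _)) 0 (fun _ => z) := by
  rw [chainFrom, Kernel.comap_apply]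

lemma chainFrom_map_eval_zero (Q : Kernel Z Z) [IsMarkovKernel Q] (z : Z) :
    (chainFrom Q z).map (fun x => x 0) = Measure.dirac z := by
  have h : (fun x : ℕ → Z => x 0) =
      (fun y : (i : Finset.Iic 0) → Z => y ⟨0, Finset.mem_Iic.2 le_rfl⟩) ∘
        Preorder.frestrictLe (π := fun _ : ℕ => Z) 0 := rfl
  rw [h, ← Measure.map_map (by fun_prop) (by fun_prop), chainFrom_apply,
    Kernel.traj_map_frestrictLe_apply, Kernel.partialTraj_self, Kernel.id_apply,
    Measure.map_dirac' (by fun_prop)]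

lemma lintegral_eval_zero_chainFrom (Q : Kernel Z Z) [IsMarkovKernel Q] (z : Z) {h : Z → ℝ≥0∞}
    (hh : Measurable h) : ∫⁻ x, h (x 0) ∂chainFrom Q z = h z := by
  rw [← lintegral_map (f := h) (g := fun x : ℕ → Z => x 0) hh (measurable_pi_apply 0),
    chainFrom_map_eval_zero, lintegral_dirac' z hh]

/-- The chain is constructed by adding a last step: given the past up to time `n`, the next
state has law `Q (x n)`. -/
lemma lintegral_chainFrom_last_step (Q : Kernel Z Z) [IsMarkovKernel Q] (z : Z) (n : ℕ)
    {G : ((i : Finset.Iic n) → Z) → ℝ≥0∞} (hG : Measurable G) {g : Z → ℝ≥0∞}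
    (hg : Measurable g) :
    ∫⁻ x, G (Preorder.frestrictLe (π := fun _ : ℕ => Z) n x) * g (x (n + 1)) ∂chainFrom Q z =
      ∫⁻ x, G (Preorder.frestrictLe (π := fun _ : ℕ => Z) n x) * ∫⁻ y, g y ∂Q (x n)
        ∂chainFrom Q z := by
  have hgQ : Measurable fun y => ∫⁻ y', g y' ∂Q y := hg.lintegral_kernel
  rw [chainFrom_apply]
  set κ : (n : ℕ) → Kernel ((i : Finset.Iic n) → Z) Z :=
    fun n => Q.comap (fun x : (i : Finset.Iic n) → Z => x ⟨n, Finset.mem_Iic.2 le_rfl⟩)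
        (measurable_pi_apply _) with hκ
  have h := Kernel.partialTraj_compProd_eq_map_traj (X := fun _ : ℕ => Z) (κ := κ) (zero_le (a := n))
    (x₀ := fun _ => z)
  have h1 : Measurable fun p : ((i : Finset.Iic n) → Z) × Z => G p.1 * g p.2 := by fun_prop
  have h2 : Measurable fun p : (i : Finset.Iic n) → Z =>
      G p * ∫⁻ y, g y ∂Q (p ⟨n, Finset.mem_Iic.2 le_rfl⟩) :=
    hG.mul (hgQ.comp (measurable_pi_apply _))
  have e1 := lintegral_map (μ := Kernel.traj (X := fun _ : ℕ => Z) κ 0 (fun _ => z)) h1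
    (g := fun x => (Preorder.frestrictLe (π := fun _ : ℕ => Z) n x, x (n + 1))) (by fun_prop)
  have e2 := lintegral_map (μ := Kernel.traj (X := fun _ : ℕ => Z) κ 0 (fun _ => z)) h2
    (g := Preorder.frestrictLe (π := fun _ : ℕ => Z) n) (by fun_prop)
  refine e1.symm.trans (Eq.trans ?_ e2)
  rw [← h, Measure.lintegral_compProd h1, Kernel.traj_map_frestrictLe_apply]
  refine lintegral_congr fun p => ?_
  exact lintegral_const_mul (μ := Q (p ⟨n, Finset.mem_Iic.2 le_rfl⟩)) (G p) hg

lemma lintegral_prod_mul_chainFrom_last_step (Q : Kernel Z Z) [IsMarkovKernel Q] (z : Z)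
    {f : ℕ → Z → ℝ≥0∞} (hf : ∀ i, Measurable (f i)) {g : Z → ℝ≥0∞} (hg : Measurable g) (n : ℕ) :
    ∫⁻ x, (∏ i ∈ Finset.range (n + 1), f i (x i)) * g (x (n + 1)) ∂chainFrom Q z =
      ∫⁻ x, (∏ i ∈ Finset.range n, f i (x i)) * (f n (x n) * ∫⁻ y, g y ∂Q (x n))
        ∂chainFrom Q z := by
  have hG : Measurable fun p : (i : Finset.Iic n) → Z =>
      ∏ i : Finset.Iic n, f i (p i) :=
    Finset.measurable_prod _ fun i _ => (hf i).comp (measurable_pi_apply i)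
  have e : ∀ x : ℕ → Z, ∏ i : Finset.Iic n,
      f i (Preorder.frestrictLe (π := fun _ : ℕ => Z) n x i) =
        ∏ i ∈ Finset.range (n + 1), f i (x i) := by
    intro x
    rw [Nat.range_succ_eq_Iic]
    exact Finset.prod_coe_sort (Finset.Iic n) fun i => f i (x i)
  have h := lintegral_chainFrom_last_step Q z n hG hg
  simp only [e] at h
  rw [h]
  simp only [Finset.prod_range_succ, mul_assoc]

/-- The Markov property at time one, for products of functions of the coordinates. -/
lemma lintegral_prod_mul_chainFrom_first_step (Q : Kernel Z Z) [IsMarkovKernel Q] (z : Z)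
    {f : ℕ → Z → ℝ≥0∞} (hf : ∀ i, Measurable (f i)) (n : ℕ) {g : Z → ℝ≥0∞} (hg : Measurable g) :
    ∫⁻ x, (∏ i ∈ Finset.range (n + 1), f i (x i)) * g (x (n + 1)) ∂chainFrom Q z =
      f 0 z * ∫⁻ z', ∫⁻ x, (∏ i ∈ Finset.range n, f (i + 1) (x i)) * g (x n) ∂chainFrom Q z'
        ∂Q z := by
  induction n generalizing g with
  | zero =>
    rw [lintegral_prod_mul_chainFrom_last_step Q z hf hg]
    simp only [Finset.range_zero, Finset.prod_empty, one_mul]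
    rw [lintegral_eval_zero_chainFrom Q z (h := fun y => f 0 y * ∫⁻ y', g y' ∂Q y)
      ((hf 0).mul hg.lintegral_kernel)]
    simp only [lintegral_eval_zero_chainFrom Q _ hg]
  | succ n ih =>
    have hg' : Measurable fun y => f (n + 1) y * ∫⁻ y', g y' ∂Q y :=
      (hf (n + 1)).mul hg.lintegral_kernel
    rw [lintegral_prod_mul_chainFrom_last_step Q z hf hg, ih hg']
    simp only [lintegral_prod_mul_chainFrom_last_step Q _ (fun i => hf (i + 1)) hg]

/-- The Markov property at time one: the chain started at `z` is `z` followed by the chain started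
at a `Q z`-distributed point. Both sides agree on cylinders, which generate the product
`σ`-algebra. -/
lemma chainFrom_eq_bind (Q : Kernel Z Z) [IsMarkovKernel Q] (z : Z) :
    chainFrom Q z = (Q z).bind ((chainFrom Q).map (consSeq z)) := by
  have : IsMarkovKernel ((chainFrom Q).map (consSeq z)) :=
    Kernel.IsMarkovKernel.map _ (measurable_consSeq_right z)
  refine ext_of_generate_finite
    (squareCylinders fun _ : ℕ => {s : Set Z | MeasurableSet s}) generateFrom_squareCylinders.symm
    (isPiSystem_squareCylinders (fun _ => MeasurableSpace.isPiSystem_measurableSet)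
      fun _ => MeasurableSet.univ) ?_ (by simp)
  rintro _ ⟨s, t, ht, rfl⟩
  have ht' : ∀ i, MeasurableSet (t i) := fun i => ht i trivial
  obtain ⟨n, hn⟩ : ∃ n, s ⊆ Finset.range n := s.exists_nat_subset_range
  classical
  let u : ℕ → Set Z := fun i => if i ∈ s then t i else Set.univ
  have hu : ∀ i, MeasurableSet (u i) := fun i => by
    by_cases hi : i ∈ s <;> simp [u, hi, ht']
  let f : ℕ → Z → ℝ≥0∞ := fun i => (u i).indicator 1
  have hf : ∀ i, Measurable (f i) := fun i => measurable_one.indicator (hu i)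
  have hms : MeasurableSet ((s : Set ℕ).pi t) :=
    MeasurableSet.pi s.countable_toSet fun i _ => ht' i
  -- The indicator of the cylinder, padded with an irrelevant constant factor at time `n + 1`.
  have key : ∀ x : ℕ → Z, ((s : Set ℕ).pi t).indicator (1 : (ℕ → Z) → ℝ≥0∞) x =
      (∏ i ∈ Finset.range (n + 1), f i (x i)) * 1 := by
    intro x
    rw [mul_one]
    by_cases hx : x ∈ (s : Set ℕ).pi t
    · rw [Set.indicator_of_mem hx]
      refine (Finset.prod_eq_one fun i _ => ?_).symm
      by_cases hi : i ∈ s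
      · simp [f, u, hi, hx i hi]
      · simp [f, u, hi]
    · rw [Set.indicator_of_notMem hx]
      simp only [Set.mem_pi, not_forall] at hx
      obtain ⟨i, hi, hxi⟩ := hx
      refine (Finset.prod_eq_zero (i := i)
        (Finset.mem_range.2 ((Finset.mem_range.1 (hn hi)).trans n.lt_succ_self)) ?_).symm
      simp [f, u, Finset.mem_coe.1 hi, hxi]
  rw [Measure.bind_apply hms (Kernel.aemeasurable _), ← lintegral_indicator_one hms]
  simp only [key]
  rw [lintegral_prod_mul_chainFrom_first_step Q z hf n (g := fun _ => 1) measurable_const,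
    ← lintegral_const_mul' _ _ (by by_cases h : z ∈ u 0 <;> simp [f, h])]
  refine lintegral_congr fun z' => ?_
  have hm : Measurable fun x : ℕ → Z => (∏ i ∈ Finset.range n, f (i + 1) (x i)) * (1 : ℝ≥0∞) :=
    (Finset.measurable_prod _ fun i _ => (hf (i + 1)).comp (measurable_pi_apply i)).mul_const 1
  rw [← lintegral_indicator_one hms, Kernel.lintegral_map _ (measurable_consSeq_right z) _
    (measurable_one.indicator hms), ← lintegral_const_mul _ hm]
  refine lintegral_congr fun x => ?_
  rw [key, Finset.prod_range_succ', mul_one, mul_one, mul_comm]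
  rfl

lemma lintegral_chainFrom (Q : Kernel Z Z) [IsMarkovKernel Q] (z : Z)
    {F : (ℕ → Z) → ℝ≥0∞} (hF : Measurable F) :
    ∫⁻ x, F x ∂chainFrom Q z = ∫⁻ z', ∫⁻ x, F (consSeq z x) ∂chainFrom Q z' ∂Q z := by
  rw [chainFrom_eq_bind, Measure.lintegral_bind (Kernel.aemeasurable _) hF.aemeasurable]
  exact lintegral_congr fun z' => Kernel.lintegral_map _ (measurable_consSeq_right z) _ hF

/-- The chain started at `z` has first coordinate `z` almost surely, in a form which does not need
`{z}` to be measurable. -/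
lemma lintegral_chainFrom_consSeq_tail (Q : Kernel Z Z) [IsMarkovKernel Q] (z : Z)
    {F : (ℕ → Z) → ℝ≥0∞} (hF : Measurable F) :
    ∫⁻ x, F (consSeq z fun n => x (n + 1)) ∂chainFrom Q z = ∫⁻ x, F x ∂chainFrom Q z := by
  have h : Measurable fun x : ℕ → Z => F (consSeq z fun n => x (n + 1)) :=
    hF.comp ((measurable_consSeq_right z).comp
      (measurable_pi_lambda _ fun n => measurable_pi_apply (n + 1)))
  rw [lintegral_chainFrom Q z h, lintegral_chainFrom Q z hF]
  rfl

end Chain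

/-! ### Stationarity and shift invariance of the two-sided chain -/

section TwoSided

variable {Z : Type*} [MeasurableSpace Z]

lemma lintegral_twoSidedFrom (k : ℤ) (Q Qs : Kernel Z Z) [IsMarkovKernel Q] [IsMarkovKernel Qs]
    (z : Z) {F : (ℤ → Z) → ℝ≥0∞} (hF : Measurable F) :
    ∫⁻ x, F x ∂twoSidedFrom k Q Qs z =
      ∫⁻ f, ∫⁻ b, F (glue k (f, b)) ∂chainFrom Qs z ∂chainFrom Q z := by
  have hm : Measurable fun p : (ℕ → Z) × (ℕ → Z) => F (glue k p) := hF.comp (measurable_glue k)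
  rw [twoSidedFrom, Kernel.lintegral_map _ (measurable_glue k) _ hF, Kernel.lintegral_prod _ _ _ hm]

lemma lintegral_twoSidedChain (k : ℤ) (ν : Measure Z) (Q Qs : Kernel Z Z) [IsMarkovKernel Q]
    [IsMarkovKernel Qs] {F : (ℤ → Z) → ℝ≥0∞} (hF : Measurable F) :
    ∫⁻ x, F x ∂twoSidedChain k ν Q Qs = ∫⁻ z, ∫⁻ x, F x ∂twoSidedFrom k Q Qs z ∂ν := by
  rw [twoSidedChain, Measure.lintegral_bind (Kernel.aemeasurable _) hF.aemeasurable]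

/-- Given `Z_k = z`, a factor depending on the coordinate at `k` is the constant `h z`. -/
lemma lintegral_eval_mul_twoSidedFrom (k : ℤ) (Q Qs : Kernel Z Z) [IsMarkovKernel Q]
    [IsMarkovKernel Qs] (z : Z) {h : Z → ℝ≥0∞} (hh : Measurable h) {F : (ℤ → Z) → ℝ≥0∞}
    (hF : Measurable F) :
    ∫⁻ x, h (x k) * F x ∂twoSidedFrom k Q Qs z = h z * ∫⁻ x, F x ∂twoSidedFrom k Q Qs z := by
  have hm : Measurable fun p : (ℕ → Z) × (ℕ → Z) => F (glue k p) := hF.comp (measurable_glue k)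
  have hG : Measurable fun f : ℕ → Z => ∫⁻ b, F (glue k (f, b)) ∂chainFrom Qs z :=
    hm.lintegral_prod_right'
  have hG' : Measurable fun f : ℕ → Z => h (f 0) * ∫⁻ b, F (glue k (f, b)) ∂chainFrom Qs z :=
    (hh.comp (measurable_pi_apply 0)).mul hG
  have hhF : Measurable fun x : ℤ → Z => h (x k) * F x :=
    (hh.comp (measurable_pi_apply k)).mul hF
  rw [lintegral_twoSidedFrom k Q Qs z hhF,
    lintegral_twoSidedFrom k Q Qs z hF]
  have e : ∀ f : ℕ → Z, ∫⁻ b, h (glue k (f, b) k) * F (glue k (f, b)) ∂chainFrom Qs z =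
      h (f 0) * ∫⁻ b, F (glue k (f, b)) ∂chainFrom Qs z := fun f => by
    have hmf : Measurable fun b => F (glue k (f, b)) := hm.comp measurable_prodMk_left
    rw [← lintegral_const_mul _ hmf]
    simp [glue]
  simp only [e]
  rw [← lintegral_chainFrom_consSeq_tail Q z hG', ← lintegral_chainFrom_consSeq_tail Q z hG]
  simp only [consSeq]
  rw [lintegral_const_mul]
  exact hG.comp ((measurable_consSeq_right z).comp
      (measurable_pi_lambda _ fun n => measurable_pi_apply (n + 1)))

/-- Reversibility on rectangles extends to all measurable sets when `ν` is `σ`-finite. -/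
lemma IsReversibleTriplet.map_swap_compProd {ν : Measure Z} [SigmaFinite ν] {Q Qs : Kernel Z Z}
    [IsMarkovKernel Q] [IsMarkovKernel Qs] (hrev : IsReversibleTriplet ν Q Qs) :
    (ν ⊗ₘ Qs).map Prod.swap = ν ⊗ₘ Q := by
  have hrect : ∀ A B : Set Z, MeasurableSet A → MeasurableSet B →
      (ν ⊗ₘ Qs).map Prod.swap (A ×ˢ B) = (ν ⊗ₘ Q) (A ×ˢ B) := fun A B hA hB => by
    rw [Measure.map_apply measurable_swap (hA.prod hB), Set.preimage_swap_prod,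
      Measure.compProd_apply_prod hB hA, Measure.compProd_apply_prod hA hB, hrev A B hA hB]
  symm
  refine Measure.ext_of_generateFrom_of_iUnion _ (fun n => spanningSets ν n ×ˢ Set.univ)
    generateFrom_prod.symm isPiSystem_prod ?_ ?_ ?_ ?_
  · rw [← Set.iUnion_prod_const, iUnion_spanningSets, Set.univ_prod_univ]
  · exact fun n => ⟨_, measurableSet_spanningSets ν n, _, MeasurableSet.univ, rfl⟩
  · intro n
    rw [Measure.compProd_apply_prod (measurableSet_spanningSets ν n) MeasurableSet.univ]
    simpa using (measure_spanningSets_lt_top ν n).ne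
  · rintro _ ⟨A, hA, B, hB, rfl⟩
    exact (hrect A B hA hB).symm

/-- Moving the base point of the two-sided chain one step to the right amounts to traversing one
transition backwards with `Q*` instead of forwards with `Q`; by reversibility this leaves the law
unchanged. -/
lemma twoSidedChain_add_one {ν : Measure Z} [SigmaFinite ν] {Q Qs : Kernel Z Z}
    [IsMarkovKernel Q] [IsMarkovKernel Qs] (hrev : IsReversibleTriplet ν Q Qs) (k : ℤ) :
    twoSidedChain (k + 1) ν Q Qs = twoSidedChain k ν Q Qs := by
  refine Measure.ext_of_lintegral _ fun F hF => ?_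
  have hFg : ∀ j : ℤ, Measurable fun p : (ℕ → Z) × (ℕ → Z) => F (glue j p) :=
    fun j => hF.comp (measurable_glue j)
  -- The integral of `F` given `Z_k = p.1` and `Z_{k+1} = p.2`.
  let κ : Kernel (Z × Z) ((ℕ → Z) × (ℕ → Z)) :=
    Kernel.prodMkLeft Z (chainFrom Q) ×ₖ Kernel.prodMkRight Z (chainFrom Qs)
  let H : Z × Z → ℝ≥0∞ := fun p => ∫⁻ q, F (glue k (consSeq p.1 q.1, q.2)) ∂κ p
  have hFH : Measurable fun r : (Z × Z) × ((ℕ → Z) × (ℕ → Z)) =>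
      F (glue k (consSeq r.1.1 r.2.1, r.2.2)) :=
    (hFg k).comp ((measurable_consSeq.comp
      ((measurable_fst.comp measurable_fst).prodMk (measurable_fst.comp measurable_snd))).prodMk
      (measurable_snd.comp measurable_snd))
  have hH : Measurable H := hFH.lintegral_kernel_prod_right'
  have hHeq : ∀ z z', H (z, z') =
      ∫⁻ f, ∫⁻ b, F (glue k (consSeq z f, b)) ∂chainFrom Qs z ∂chainFrom Q z' := fun z z' => by
    have := Kernel.lintegral_prod (Kernel.prodMkLeft Z (chainFrom Q))
      (Kernel.prodMkRight Z (chainFrom Qs)) (z, z')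
      (g := fun q => F (glue k (consSeq z q.1, q.2)))
      (hFH.comp (measurable_prodMk_left (x := (z, z'))))
    simpa only [Kernel.prodMkLeft_apply, Kernel.prodMkRight_apply] using this
  have forward : ∀ z, ∫⁻ x, F x ∂twoSidedFrom k Q Qs z = ∫⁻ z', H (z, z') ∂Q z := fun z => by
    rw [lintegral_twoSidedFrom k Q Qs z hF, lintegral_chainFrom Q z (hFg k).lintegral_prod_right']
    simp only [hHeq]
  have backward : ∀ z', ∫⁻ x, F x ∂twoSidedFrom (k + 1) Q Qs z' = ∫⁻ z, H (z, z') ∂Qs z' := by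
    intro z'
    have hswap := lintegral_lintegral_swap (μ := chainFrom Q z') (ν := chainFrom Qs z')
      (f := fun f b => F (glue (k + 1) (f, b))) (hFg (k + 1)).aemeasurable
    rw [lintegral_twoSidedFrom (k + 1) Q Qs z' hF, hswap,
      lintegral_chainFrom Qs z' (hFg (k + 1)).lintegral_prod_left']
    refine lintegral_congr fun z => ?_
    have hm : Measurable fun p : (ℕ → Z) × (ℕ → Z) => F (glue (k + 1) (p.1, consSeq z' p.2)) :=
      (hFg (k + 1)).comp (measurable_fst.prodMk ((measurable_consSeq_right z').comp measurable_snd))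
    have hswap' := lintegral_lintegral_swap (μ := chainFrom Qs z) (ν := chainFrom Q z')
      (f := fun b f => F (glue (k + 1) (f, consSeq z' b))) (hm.comp measurable_swap).aemeasurable
    rw [hswap', hHeq]
    refine lintegral_congr fun f => ?_
    have hb : Measurable fun b : ℕ → Z => F (glue (k + 1) (f, consSeq z' b)) :=
      hm.comp measurable_prodMk_left
    -- Gluing at `k + 1` reads the coordinate at `k` off the backward chain, gluing at `k` takes it
    -- to be `z`; the backward chain starts at `z` almost surely.
    rw [← lintegral_chainFrom_consSeq_tail Qs z hb]
    refine lintegral_congr fun b => congrArg F (funext fun i => ?_)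
    rcases lt_trichotomy i k with hi | rfl | hi
    · have h1 : ¬ k + 1 ≤ i := by omega
      have h2 : ¬ k ≤ i := by omega
      obtain ⟨n, hn⟩ : ∃ n : ℕ, k - i = n + 1 := ⟨(k - i - 1).toNat, by omega⟩
      have h3 : (k - i).toNat = n + 1 := by omega
      have h4 : (k + 1 - i).toNat = n + 1 + 1 := by omega
      simp only [glue, h1, h2, if_false, h3, h4, consSeq]
    · simp [glue, consSeq]
    · have h1 : k + 1 ≤ i := by omega
      have h2 : k ≤ i := by omega
      obtain ⟨n, hn⟩ : ∃ n : ℕ, i - k = n + 1 := ⟨(i - k - 1).toNat, by omega⟩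
      have h3 : (i - k).toNat = n + 1 := by omega
      have h4 : (i - (k + 1)).toNat = n := by omega
      simp only [glue, h1, h2, if_true, h3, h4, consSeq]
  rw [lintegral_twoSidedChain _ _ _ _ hF, lintegral_twoSidedChain _ _ _ _ hF]
  simp only [forward, backward]
  have hHs : Measurable fun p : Z × Z => H p.swap := hH.comp measurable_swap
  rw [← Measure.lintegral_compProd hH, ← hrev.map_swap_compProd, lintegral_map hH measurable_swap,
    Measure.lintegral_compProd hHs]
  rfl

lemma twoSidedChain_eq_zero {ν : Measure Z} [SigmaFinite ν] {Q Qs : Kernel Z Z}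
    [IsMarkovKernel Q] [IsMarkovKernel Qs] (hrev : IsReversibleTriplet ν Q Qs) (k : ℤ) :
    twoSidedChain k ν Q Qs = twoSidedChain 0 ν Q Qs := by
  induction k with
  | zero => rfl
  | succ n ih => rw [twoSidedChain_add_one hrev, ih]
  | pred n ih => rw [← ih, ← twoSidedChain_add_one hrev (-(n : ℤ) - 1), sub_add_cancel]

lemma shift_glue {Y : Type*} (k : ℤ) (p : (ℕ → Y) × (ℕ → Y)) : shift k (glue 0 p) = glue (-k) p := by
  funext i
  have h1 : (0 ≤ k + i) = (-k ≤ i) := propext ⟨fun h => by omega, fun h => by omega⟩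
  have h2 : k + i - 0 = i - -k := by ring
  have h3 : 0 - (k + i) = -k - i := by ring
  simp only [shift, glue, h1, h2, h3]

lemma map_shift_twoSidedChain {ν : Measure Z} [SigmaFinite ν] {Q Qs : Kernel Z Z}
    [IsMarkovKernel Q] [IsMarkovKernel Qs] (hrev : IsReversibleTriplet ν Q Qs) (k : ℤ) :
    (twoSidedChain 0 ν Q Qs).map (shift k) = twoSidedChain 0 ν Q Qs := by
  conv_rhs => rw [← twoSidedChain_eq_zero hrev (-k)]
  refine Measure.ext_of_lintegral _ fun F hF => ?_
  have hFs : Measurable fun x : ℤ → Z => F (shift k x) := hF.comp (measurable_shift k)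
  rw [lintegral_map hF (measurable_shift k), lintegral_twoSidedChain _ _ _ _ hF]
  refine (lintegral_twoSidedChain 0 ν Q Qs hFs).trans (lintegral_congr fun z => ?_)
  rw [lintegral_twoSidedFrom _ _ _ _ hFs, lintegral_twoSidedFrom _ _ _ _ hF]
  simp only [shift_glue]

lemma twoSidedChain_withDensity (k : ℤ) (ν : Measure Z) (Q Qs : Kernel Z Z)
    [IsMarkovKernel Q] [IsMarkovKernel Qs] {h : Z → ℝ≥0∞} (hh : Measurable h) :
    twoSidedChain k (ν.withDensity h) Q Qs =
      (twoSidedChain k ν Q Qs).withDensity fun x => h (x k) := by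
  refine Measure.ext_of_lintegral _ fun F hF => ?_
  have hhk : Measurable fun x : ℤ → Z => h (x k) := hh.comp (measurable_pi_apply k)
  have hhF : Measurable fun x : ℤ → Z => h (x k) * F x := hhk.mul hF
  rw [lintegral_withDensity_eq_lintegral_mul _ hhk hF]
  simp only [Pi.mul_apply]
  rw [lintegral_twoSidedChain k ν Q Qs hhF, lintegral_twoSidedChain _ _ _ _ hF,
    lintegral_withDensity_eq_lintegral_mul _ hh hF.lintegral_kernel]
  exact lintegral_congr fun z => (lintegral_eval_mul_twoSidedFrom k Q Qs z hh hF).symm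

end TwoSided

/-! ### Reduction to a `σ`-finite reference measure -/

section Reduction

variable {Z : Type*} [MeasurableSpace Z]

lemma IsReversibleTriplet.symm {ν : Measure Z} {Q Qs : Kernel Z Z}
    (hrev : IsReversibleTriplet ν Q Qs) : IsReversibleTriplet ν Qs Q :=
  fun A B hA hB => (hrev B A hB hA).symm

lemma IsReversibleTriplet.bind_eq {ν : Measure Z} {Q Qs : Kernel Z Z} [IsMarkovKernel Qs]
    (hrev : IsReversibleTriplet ν Q Qs) : ν.bind Q = ν := by
  ext B hB
  rw [Measure.bind_apply hB (Kernel.aemeasurable _)]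
  simpa using hrev Set.univ B MeasurableSet.univ hB

lemma IsReversibleTriplet.lintegral_lintegral {ν : Measure Z} {Q Qs : Kernel Z Z}
    [IsMarkovKernel Qs] (hrev : IsReversibleTriplet ν Q Qs) {g : Z → ℝ≥0∞} (hg : Measurable g) :
    ∫⁻ z, ∫⁻ y, g y ∂Q z ∂ν = ∫⁻ z, g z ∂ν := by
  rw [← Measure.lintegral_bind (Kernel.aemeasurable _) hg.aemeasurable, hrev.bind_eq]

/-- If `Q*` does not enter `E` from outside, then by reversibility `Q` does not leave `E`. -/
lemma IsReversibleTriplet.setLIntegral_inter {ν : Measure Z} {Q Qs : Kernel Z Z}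
    (hrev : IsReversibleTriplet ν Q Qs) {E : Set Z} (hE : MeasurableSet E)
    (hQs : ∀ z ∉ E, Qs z E = 0) {A B : Set Z} (hA : MeasurableSet A) (hB : MeasurableSet B) :
    ∫⁻ z in A ∩ E, Q z B ∂ν = ∫⁻ z in A ∩ E, Q z (B ∩ E) ∂ν := by
  have h0 : ∫⁻ z in A ∩ E, Q z (B \ E) ∂ν = 0 := by
    rw [hrev _ _ (hA.inter hE) (hB.diff hE), setLIntegral_congr_fun (g := fun _ => 0)
      (hB.diff hE) fun z hz => measure_mono_null Set.inter_subset_right (hQs z hz.2)]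
    simp
  rw [← add_zero (∫⁻ z in A ∩ E, Q z (B ∩ E) ∂ν), ← h0,
    ← lintegral_add_left (Q.measurable_coe (hB.inter hE))]
  simp only [measure_inter_add_sdiff _ hE]

lemma IsReversibleTriplet.restrict {ν : Measure Z} {Q Qs : Kernel Z Z}
    (hrev : IsReversibleTriplet ν Q Qs) {E : Set Z} (hE : MeasurableSet E)
    (hQ : ∀ z ∉ E, Q z E = 0) (hQs : ∀ z ∉ E, Qs z E = 0) :
    IsReversibleTriplet (ν.restrict E) Q Qs := fun A B hA hB => by
  rw [Measure.restrict_restrict hA, Measure.restrict_restrict hB,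
    hrev.setLIntegral_inter hE hQs hA hB, hrev.symm.setLIntegral_inter hE hQ hB hA,
    hrev _ _ (hA.inter hE) (hB.inter hE)]

/-- One step of the chain in either direction: `g ↦ Q g + Q* g`. -/
noncomputable def stepSum (Q Qs : Kernel Z Z) (g : Z → ℝ≥0∞) : Z → ℝ≥0∞ :=
  fun z => ∫⁻ y, g y ∂Q z + ∫⁻ y, g y ∂Qs z

lemma measurable_stepSum_iterate (Q Qs : Kernel Z Z) {g : Z → ℝ≥0∞} (hg : Measurable g) (n : ℕ) :
    Measurable ((stepSum Q Qs)^[n] g) := by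
  induction n with
  | zero => exact hg
  | succ n ih =>
    rw [Function.iterate_succ_apply']
    exact ih.lintegral_kernel.add ih.lintegral_kernel

lemma IsReversibleTriplet.lintegral_stepSum_iterate {ν : Measure Z} {Q Qs : Kernel Z Z}
    [IsMarkovKernel Q] [IsMarkovKernel Qs] (hrev : IsReversibleTriplet ν Q Qs) {g : Z → ℝ≥0∞}
    (hg : Measurable g) (n : ℕ) :
    ∫⁻ z, (stepSum Q Qs)^[n] g z ∂ν = 2 ^ n * ∫⁻ z, g z ∂ν := by
  induction n with
  | zero => simp
  | succ n ih =>
    have hm := measurable_stepSum_iterate Q Qs hg n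
    simp only [Function.iterate_succ_apply', stepSum]
    rw [lintegral_add_left hm.lintegral_kernel, hrev.lintegral_lintegral hm,
      hrev.symm.lintegral_lintegral hm, ih, pow_succ]
    ring

lemma sigmaFinite_restrict_ne_zero {ν : Measure Z} {G : Z → ℝ≥0∞} (hG : Measurable G)
    (hfin : ∫⁻ z, G z ∂ν ≠ ∞) : SigmaFinite (ν.restrict {z | G z ≠ 0}) := by
  have hE : MeasurableSet {z | G z ≠ 0} := (measurableSet_singleton 0).compl.preimage hG
  have hfin' : ∫⁻ z, G z ∂ν.restrict {z | G z ≠ 0} ≠ ∞ :=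
    ne_top_of_le_ne_top hfin (lintegral_mono' Measure.restrict_le_self le_rfl)
  have h0 : ∀ᵐ z ∂ν.restrict {z | G z ≠ 0}, G z ≠ 0 := ae_restrict_mem hE
  have := isFiniteMeasure_withDensity hfin'
  rw [← withDensity_inv_same hG h0 ((ae_lt_top hG hfin').mono fun _ h => h.ne)]
  refine SigmaFinite.withDensity_of_ne_top ?_
  refine (withDensity_absolutelyContinuous _ _).ae_le (h0.mono fun z hz => ?_)
  exact ENNReal.inv_ne_top.2 hz

/-- The measure `ν` need not be `σ`-finite, but only its restriction to the states which can be
reached from `{ϖ > 0}` by finitely many forward or backward steps matters. That set is the set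
`{G > 0}` for `G = ∑ₙ 4⁻ⁿ Lⁿ ϖ`, `L = Q + Q*`, and `∫ G dν = 2` because `ν` is invariant. -/
lemma exists_sigmaFinite_reference {pi ν : Measure Z} [IsProbabilityMeasure pi]
    {Q Qs : Kernel Z Z} [IsMarkovKernel Q] [IsMarkovKernel Qs] {w : Z → ℝ≥0}
    (hw : HasRNDeriv pi ν w) (hrev : IsReversibleTriplet ν Q Qs) :
    ∃ ν' : Measure Z, SigmaFinite ν' ∧ pi = ν'.withDensity (fun z => (w z : ℝ≥0∞)) ∧
      IsReversibleTriplet ν' Q Qs := by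
  obtain ⟨hwm, hpi⟩ := hw
  have hwm' : Measurable fun z => (w z : ℝ≥0∞) := measurable_coe_nnreal_ennreal.comp hwm
  have hpi' : pi = ν.withDensity fun z => (w z : ℝ≥0∞) := by
    ext A hA
    rw [hpi A hA, withDensity_apply _ hA]
  have hw1 : ∫⁻ z, (w z : ℝ≥0∞) ∂ν = 1 := by
    rw [← setLIntegral_univ, ← hpi _ MeasurableSet.univ, measure_univ]
  let T : ℕ → Z → ℝ≥0∞ := fun n => (stepSum Q Qs)^[n] fun z => (w z : ℝ≥0∞)
  have hT : ∀ n, Measurable (T n) := measurable_stepSum_iterate Q Qs hwm'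
  let G : Z → ℝ≥0∞ := fun z => ∑' n, (4⁻¹ : ℝ≥0∞) ^ n * T n z
  have hTG : ∀ n, Measurable fun z => (4⁻¹ : ℝ≥0∞) ^ n * T n z := fun n => (hT n).const_mul _
  have hG : Measurable G := Measurable.tsum hTG
  have hE : MeasurableSet {z | G z ≠ 0} := (measurableSet_singleton 0).compl.preimage hG
  have hG0 : ∀ z, G z = 0 ↔ ∀ n, T n z = 0 := fun z => by
    simp [G, ENNReal.tsum_eq_zero]
  have hfin : ∫⁻ z, G z ∂ν ≠ ∞ := by
    have h : ∀ n : ℕ, (4⁻¹ : ℝ≥0∞) ^ n * (2 ^ n * 1) = 2⁻¹ ^ n := fun n => by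
      rw [mul_one, ← mul_pow]
      congr 1
      rw [show (4 : ℝ≥0∞) = 2 * 2 by norm_num, ENNReal.mul_inv (by simp) (by simp), mul_assoc,
        ENNReal.inv_mul_cancel (by simp) (by simp), mul_one]
    rw [lintegral_tsum fun n => (hTG n).aemeasurable]
    simp only [lintegral_const_mul _ (hT _), T, hrev.lintegral_stepSum_iterate hwm', hw1, h]
    rw [ENNReal.tsum_geometric]
    simp
  have hclosed : ∀ z ∉ {z | G z ≠ 0}, Q z {z | G z ≠ 0} = 0 ∧ Qs z {z | G z ≠ 0} = 0 := by
    intro z hz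
    have hz0 : ∀ n, ∫⁻ y, T n y ∂Q z = 0 ∧ ∫⁻ y, T n y ∂Qs z = 0 := fun n => by
      have h := (hG0 z).1 (not_not.1 hz) (n + 1)
      simp only [T, Function.iterate_succ_apply', stepSum, add_eq_zero] at h
      exact h
    have hint : ∫⁻ y, G y ∂Q z = 0 ∧ ∫⁻ y, G y ∂Qs z = 0 := by
      simp only [G]
      rw [lintegral_tsum fun n => (hTG n).aemeasurable, lintegral_tsum fun n => (hTG n).aemeasurable]
      simp [lintegral_const_mul _ (hT _), hz0]
    exact ⟨(lintegral_eq_zero_iff hG).1 hint.1, (lintegral_eq_zero_iff hG).1 hint.2⟩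
  refine ⟨ν.restrict {z | G z ≠ 0}, sigmaFinite_restrict_ne_zero hG hfin, ?_,
    hrev.restrict hE (fun z hz => (hclosed z hz).1) fun z hz => (hclosed z hz).2⟩
  rw [← withDensity_indicator hE, hpi']
  congr 1
  have hsupp : Function.support (fun z => (w z : ℝ≥0∞)) ⊆ {z | G z ≠ 0} :=
    fun z hz hGz => hz ((hG0 z).1 hGz 0)
  exact (Set.indicator_eq_self.2 hsupp).symm

end Reduction

/-! ### Metropolis–Hastings with a measure-preserving involution -/

section Involution

variable {E : Type*} [MeasurableSpace E] {M : Measure E}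

lemma hasRNDeriv_restrict_withDensity {f g : E → ℝ≥0} (hf : Measurable f) (hg : Measurable g)
    {S : Set E} (hS : MeasurableSet S) (hgS : ∀ x ∈ S, 0 < g x) {r : E → ℝ≥0} (hr : Measurable r)
    (hrS : ∀ x ∈ S, r x = f x / g x) :
    HasRNDeriv ((M.withDensity fun x => (f x : ℝ≥0∞)).restrict S)
      ((M.withDensity fun x => (g x : ℝ≥0∞)).restrict S) r := by
  refine ⟨hr, fun A hA => ?_⟩
  have hf' : Measurable fun x => (f x : ℝ≥0∞) := measurable_coe_nnreal_ennreal.comp hf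
  have hg' : Measurable fun x => (g x : ℝ≥0∞) := measurable_coe_nnreal_ennreal.comp hg
  have hr' : Measurable fun x => (r x : ℝ≥0∞) := measurable_coe_nnreal_ennreal.comp hr
  rw [Measure.restrict_restrict hA, Measure.restrict_apply hA, withDensity_apply _ (hA.inter hS),
    setLIntegral_withDensity_eq_setLIntegral_mul _ hg' hr' (hA.inter hS)]
  refine setLIntegral_congr_fun (hA.inter hS) fun x hx => ?_
  simp only [Pi.mul_apply]
  rw [hrS x hx.2, ← ENNReal.coe_mul, mul_div_cancel₀ _ (hgS x hx.2).ne']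

lemma restrict_withDensity_absolutelyContinuous {f g : E → ℝ≥0} (hf : Measurable f)
    {S : Set E} (hS : MeasurableSet S) (hfS : ∀ x ∈ S, 0 < f x) :
    (M.withDensity fun x => (g x : ℝ≥0∞)).restrict S ≪
      (M.withDensity fun x => (f x : ℝ≥0∞)).restrict S := by
  rw [restrict_withDensity hS, restrict_withDensity hS]
  refine (withDensity_absolutelyContinuous _ _).trans (withDensity_absolutelyContinuous'
    (measurable_coe_nnreal_ennreal.comp hf).aemeasurable ?_)
  exact ae_restrict_of_forall_mem hS fun x hx => ENNReal.coe_ne_zero.2 (hfS x hx).ne'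


lemma map_withDensity_of_involutive {φ : E → E} (hφm : Measurable φ)
    (hφ : Function.Involutive φ) (hM : M.map φ = M) {f : E → ℝ≥0∞} (hf : Measurable f) :
    (M.withDensity f).map φ = M.withDensity fun x => f (φ x) := by
  ext A hA
  have hfφ : Measurable fun x => f (φ x) := hf.comp hφm
  rw [Measure.map_apply hφm hA, withDensity_apply _ (hφm hA), withDensity_apply _ hA]
  conv_rhs => rw [← hM, setLIntegral_map hA hfφ hφm]
  simp only [hφ _]

/-- Measures with densities `f` and `g` are mutually singular on a set where `f g = 0`. -/
lemma mutuallySingular_restrict_withDensity {f g : E → ℝ≥0} (hf : Measurable f) {S : Set E}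
    (hS : MeasurableSet S) (hfg : ∀ x ∈ S, f x = 0 ∨ g x = 0) :
    (M.withDensity fun x => (f x : ℝ≥0∞)).restrict S ⟂ₘ
      (M.withDensity fun x => (g x : ℝ≥0∞)).restrict S := by
  have hN : MeasurableSet {x | f x = 0} := hf (measurableSet_singleton 0)
  refine ⟨{x | f x = 0}, hN, ?_, ?_⟩
  · rw [Measure.restrict_apply hN, withDensity_apply _ (hN.inter hS),
      setLIntegral_congr_fun (g := fun _ => 0) (hN.inter hS)
        fun x hx => ENNReal.coe_eq_zero.2 hx.1]
    simp
  · rw [Measure.restrict_apply hN.compl, withDensity_apply _ (hN.compl.inter hS),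
      setLIntegral_congr_fun (g := fun _ => 0) (hN.compl.inter hS)
        fun x hx => ENNReal.coe_eq_zero.2 ((hfg x hx.2).resolve_left hx.1)]
    simp

lemma IsAcceptanceFun.div_mul {a : ℝ≥0 → ℝ≥0} (ha : IsAcceptanceFun a) {x y : ℝ≥0} (hx : 0 < x)
    (hy : 0 < y) : a (y / x) * x = a (x / y) * y := by
  rw [ha.eq_mul _ (div_pos hy hx), one_div_div, mul_right_comm, div_mul_cancel₀ _ hx.ne', mul_comm]

lemma acceptReject_apply (φ : E → E) (hφ : Measurable φ) (α : E → ℝ≥0) (hα : Measurable α) (ξ : E)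
    {B : Set E} (hB : MeasurableSet B) :
    acceptReject φ hφ α hα ξ B =
      α ξ * B.indicator 1 (φ ξ) + ((1 - α ξ : ℝ≥0) : ℝ≥0∞) * B.indicator 1 ξ := by
  change (α ξ • Measure.dirac (φ ξ) + (1 - α ξ) • Measure.dirac ξ : Measure E) B = _
  rw [Measure.add_apply, Measure.smul_apply, Measure.smul_apply, Measure.dirac_apply' _ hB,
    Measure.dirac_apply' _ hB]
  rfl

lemma isMarkovKernel_acceptReject (φ : E → E) (hφ : Measurable φ) (α : E → ℝ≥0)
    (hα : Measurable α) (hα1 : ∀ ξ, α ξ ≤ 1) : IsMarkovKernel (acceptReject φ hφ α hα) := by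
  refine ⟨fun ξ => ⟨?_⟩⟩
  rw [acceptReject_apply φ hφ α hα ξ MeasurableSet.univ]
  simp only [Set.indicator_univ, Pi.one_apply, mul_one]
  rw [← ENNReal.coe_add, add_tsub_cancel_of_le (hα1 ξ), ENNReal.coe_one]

/-- Moves along an involution `φ` preserving `M` are reversible with respect to `m dM` as soon as
the flow `α m` of accepted mass is `φ`-invariant. -/
lemma acceptReject_isReversible {φ : E → E} (hφm : Measurable φ) (hφ : Function.Involutive φ)
    (hM : M.map φ = M) {m : E → ℝ≥0} (hm : Measurable m) {α : E → ℝ≥0} (hα : Measurable α)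
    (hbal : ∀ ξ, α (φ ξ) * m (φ ξ) = α ξ * m ξ) :
    (acceptReject φ hφm α hα).IsReversible (M.withDensity fun ξ => (m ξ : ℝ≥0∞)) := by
  have hm' : Measurable fun x => (m x : ℝ≥0∞) := measurable_coe_nnreal_ennreal.comp hm
  have hα' : Measurable fun x => (α x : ℝ≥0∞) := measurable_coe_nnreal_ennreal.comp hα
  -- Accepted and rejected mass flowing from `A` to `B`.
  let flow : Set E → Set E → E → ℝ≥0∞ := fun A B ξ =>
    A.indicator 1 ξ * B.indicator 1 (φ ξ) * (α ξ * m ξ : ℝ≥0)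
  let stay : Set E → Set E → E → ℝ≥0∞ := fun A B ξ =>
    A.indicator 1 ξ * B.indicator 1 ξ * ((1 - α ξ) * m ξ : ℝ≥0)
  have h1 : ∀ {A : Set E}, MeasurableSet A → Measurable (A.indicator (1 : E → ℝ≥0∞)) :=
    fun hA => measurable_one.indicator hA
  have hflow : ∀ {A B : Set E}, MeasurableSet A → MeasurableSet B → Measurable (flow A B) :=
    fun hA hB => ((h1 hA).mul ((h1 hB).comp hφm)).mul
      (measurable_coe_nnreal_ennreal.comp (hα.mul hm))
  have split : ∀ {A B : Set E}, MeasurableSet A → MeasurableSet B →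
      ∫⁻ ξ in A, acceptReject φ hφm α hα ξ B ∂(M.withDensity fun ξ => (m ξ : ℝ≥0∞)) =
        ∫⁻ ξ, flow A B ξ ∂M + ∫⁻ ξ, stay A B ξ ∂M := by
    intro A B hA hB
    rw [setLIntegral_withDensity_eq_setLIntegral_mul _ hm' (Kernel.measurable_coe _ hB) hA,
      ← lintegral_indicator hA, ← lintegral_add_left (hflow hA hB)]
    refine lintegral_congr fun ξ => ?_
    by_cases hξ : ξ ∈ A
    · simp only [Set.indicator_of_mem hξ, Pi.mul_apply, acceptReject_apply φ hφm α hα ξ hB, flow,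
        stay, Pi.one_apply, ENNReal.coe_mul]
      ring
    · simp [flow, stay, hξ]
  intro A B hA hB
  rw [split hA hB, split hB hA]
  congr 1
  · conv_lhs => rw [← hM, lintegral_map (hflow hA hB) hφm]
    refine lintegral_congr fun ξ => ?_
    simp only [flow, hφ ξ, hbal ξ]
    ring
  · refine lintegral_congr fun ξ => ?_
    simp only [stay]
    ring

end Involution

/-! ### The extended law of a sequence and a proposal index -/

section Extended

variable {Z : Type*} [MeasurableSpace Z]

lemma involutive_invo {Y : Type*} : Function.Involutive (invo (Z := Y)) := fun ξ => by
  refine Prod.ext (funext fun j => ?_) (neg_neg ξ.2)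
  simp [invo, shift]

/-- The weight `ϖ(z₀) ς(k; x)` of a pair `(x, k)`, which is the density of the extended law with
respect to the product of the stationary two-sided chain and the counting measure. -/
noncomputable def pairWeight (w : Z → ℝ≥0) (s : Kernel (ℤ → Z) ℤ) (ξ : (ℤ → Z) × ℤ) : ℝ≥0 :=
  w (ξ.1 0) * idxProb s ξ.2 ξ.1

lemma measurable_pairWeight {w : Z → ℝ≥0} (hw : Measurable w) (s : Kernel (ℤ → Z) ℤ) :
    Measurable (pairWeight w s) :=
  measurable_from_prod_countable_left fun k =>
    (hw.comp (measurable_pi_apply 0)).mul (measurable_idxProb s k)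

lemma pairWeight_invo (w : Z → ℝ≥0) (s : Kernel (ℤ → Z) ℤ) (ξ : (ℤ → Z) × ℤ) :
    pairWeight w s (invo ξ) = w (ξ.1 ξ.2) * idxProb s (-ξ.2) (shift ξ.2 ξ.1) := by
  simp [pairWeight, invo, shift]

lemma mem_extendedSet_iff {w : Z → ℝ≥0} {s : Kernel (ℤ → Z) ℤ} {ξ : (ℤ → Z) × ℤ} :
    ξ ∈ extendedSet w s ↔ 0 < pairWeight w s ξ ∧ 0 < pairWeight w s (invo ξ) := by
  rw [pairWeight_invo]
  simp only [extendedSet, pairWeight, Set.mem_ofPred_eq, lt_min_iff, pos_iff_ne_zero, mul_ne_zero_iff]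
  tauto

lemma invo_mem_extendedSet_iff {w : Z → ℝ≥0} {s : Kernel (ℤ → Z) ℤ} {ξ : (ℤ → Z) × ℤ} :
    invo ξ ∈ extendedSet w s ↔ ξ ∈ extendedSet w s := by
  rw [mem_extendedSet_iff, mem_extendedSet_iff, involutive_invo ξ, and_comm]

lemma invo_preimage_extendedSet (w : Z → ℝ≥0) (s : Kernel (ℤ → Z) ℤ) :
    invo ⁻¹' extendedSet w s = extendedSet w s :=
  Set.ext fun _ => invo_mem_extendedSet_iff

lemma invo_image_extendedSet (w : Z → ℝ≥0) (s : Kernel (ℤ → Z) ℤ) :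
    invo '' extendedSet w s = extendedSet w s := by
  rw [Set.image_eq_preimage_of_inverse involutive_invo.leftInverse involutive_invo.rightInverse,
    invo_preimage_extendedSet]

lemma acceptRatio_of_mem {w : Z → ℝ≥0} {s : Kernel (ℤ → Z) ℤ} {ξ : (ℤ → Z) × ℤ}
    (hξ : ξ ∈ extendedSet w s) :
    acceptRatio w s ξ = pairWeight w s (invo ξ) / pairWeight w s ξ := by
  rw [acceptRatio, Set.indicator_of_mem hξ, pairWeight_invo, pairWeight]

/-- Detailed balance for the accepted moves. -/
lemma acceptance_mul_pairWeight_invo (w : Z → ℝ≥0) (s : Kernel (ℤ → Z) ℤ) {a : ℝ≥0 → ℝ≥0}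
    (ha : IsAcceptanceFun a) (ξ : (ℤ → Z) × ℤ) :
    a (acceptRatio w s (invo ξ)) * pairWeight w s (invo ξ) =
      a (acceptRatio w s ξ) * pairWeight w s ξ := by
  by_cases hξ : ξ ∈ extendedSet w s
  · obtain ⟨h1, h2⟩ := mem_extendedSet_iff.1 hξ
    rw [acceptRatio_of_mem hξ, acceptRatio_of_mem (invo_mem_extendedSet_iff.2 hξ),
      involutive_invo ξ, ha.div_mul h1 h2]
  · rw [acceptRatio, Set.indicator_of_notMem hξ,
      Set.indicator_of_notMem (mt invo_mem_extendedSet_iff.1 hξ), ha.zero, zero_mul, zero_mul]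

/-- The product of a measure on sequences with the counting measure on `ℤ`. -/
noncomputable def indexedMeasure (L : Measure (ℤ → Z)) : Measure ((ℤ → Z) × ℤ) :=
  Measure.sum fun k : ℤ => L.map fun x => (x, k)

lemma lintegral_indexedMeasure (L : Measure (ℤ → Z)) {F : (ℤ → Z) × ℤ → ℝ≥0∞}
    (hF : Measurable F) : ∫⁻ ξ, F ξ ∂indexedMeasure L = ∑' k, ∫⁻ x, F (x, k) ∂L := by
  rw [indexedMeasure, lintegral_sum_measure]
  exact tsum_congr fun k => lintegral_map hF measurable_prodMk_right

lemma map_invo_indexedMeasure {L : Measure (ℤ → Z)} (hL : ∀ k, L.map (shift k) = L) :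
    (indexedMeasure L).map invo = indexedMeasure L := by
  refine Measure.ext_of_lintegral _ fun F hF => ?_
  have hFi : Measurable fun ξ => F (invo ξ) := hF.comp measurable_invo
  rw [lintegral_map hF measurable_invo, lintegral_indexedMeasure _ hF,
    lintegral_indexedMeasure _ hFi,
    ← (Equiv.neg ℤ).tsum_eq fun k => ∫⁻ x, F (x, k) ∂L]
  refine tsum_congr fun k => ?_
  conv_rhs => rw [← hL k]
  have hFk : Measurable fun x => F (x, -k) := hF.comp measurable_prodMk_right
  exact (lintegral_map hFk (measurable_shift k)).symm

lemma extendedLaw_eq_withDensity {pi : Measure Z} [IsProbabilityMeasure pi] {Q Qs : Kernel Z Z}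
    [IsMarkovKernel Q] [IsMarkovKernel Qs] {w : Z → ℝ≥0} (hw : Measurable w)
    {L : Measure (ℤ → Z)}
    (hL : twoSidedChain 0 pi Q Qs = L.withDensity fun x => (w (x 0) : ℝ≥0∞))
    (s : Kernel (ℤ → Z) ℤ) [IsMarkovKernel s] :
    extendedLaw pi Q Qs s =
      (indexedMeasure L).withDensity fun ξ => (pairWeight w s ξ : ℝ≥0∞) := by
  refine Measure.ext_of_lintegral _ fun F hF => ?_
  have hw0 : Measurable fun x : ℤ → Z => (w (x 0) : ℝ≥0∞) :=
    measurable_coe_nnreal_ennreal.comp (hw.comp (measurable_pi_apply 0))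
  have hsF : Measurable fun x => ∫⁻ k, F (x, k) ∂s x := hF.lintegral_kernel_prod_right'
  have hp : Measurable fun ξ => (pairWeight w s ξ : ℝ≥0∞) :=
    measurable_coe_nnreal_ennreal.comp (measurable_pairWeight hw s)
  have hpF : ∀ k, Measurable fun x => ((fun ξ => (pairWeight w s ξ : ℝ≥0∞)) * F) (x, k) :=
    fun k => (hp.mul hF).comp measurable_prodMk_right
  rw [extendedLaw, Measure.lintegral_compProd hF, hL,
    lintegral_withDensity_eq_lintegral_mul _ hw0 hsF,
    lintegral_withDensity_eq_lintegral_mul _ hp hF, lintegral_indexedMeasure _ (hp.mul hF),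
    ← lintegral_tsum fun k => (hpF k).aemeasurable]
  refine lintegral_congr fun x => ?_
  simp only [Pi.mul_apply]
  rw [lintegral_countable', ← ENNReal.tsum_mul_left]
  refine tsum_congr fun k => ?_
  rw [pairWeight, ENNReal.coe_mul, idxProb, ENNReal.coe_toNNReal (measure_ne_top _ _)]
  ring

/-- Integrating the transition probabilities of the Markov chain proposal kernel against `π` amounts
to integrating those of the kernel on pairs against the extended law. -/
lemma setLIntegral_mcProposalKernel {pi : Measure Z} [IsProbabilityMeasure pi] {Q Qs : Kernel Z Z}
    [IsMarkovKernel Q] [IsMarkovKernel Qs] {w : Z → ℝ≥0} (hw : Measurable w)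
    (s : Kernel (ℤ → Z) ℤ) [IsMarkovKernel s] {a : ℝ≥0 → ℝ≥0} (ha : IsAcceptanceFun a)
    {A B : Set Z} (hA : MeasurableSet A) (hB : MeasurableSet B) :
    ∫⁻ z in A, mcProposalKernel Q Qs hw s ha z B ∂pi =
      ∫⁻ ξ in (fun ξ : (ℤ → Z) × ℤ => ξ.1 0) ⁻¹' A,
        pairKernel hw s ha ξ ((fun ξ : (ℤ → Z) × ℤ => ξ.1 0) ⁻¹' B) ∂extendedLaw pi Q Qs s := by
  have hev : Measurable fun ξ : (ℤ → Z) × ℤ => ξ.1 0 := (measurable_pi_apply 0).comp measurable_fst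
  let h : (ℤ → Z) × ℤ → ℝ≥0∞ := fun ξ =>
    pairKernel hw s ha ξ ((fun ξ : (ℤ → Z) × ℤ => ξ.1 0) ⁻¹' B)
  have hh : Measurable h := Kernel.measurable_coe _ (hev hB)
  have hH : Measurable fun x => ∫⁻ k, h (x, k) ∂s x := hh.lintegral_kernel_prod_right'
  have h1 : Measurable (A.indicator (1 : Z → ℝ≥0∞)) := measurable_one.indicator hA
  have hP : ∀ z, mcProposalKernel Q Qs hw s ha z B =
      ∫⁻ x, ∫⁻ k, h (x, k) ∂s x ∂twoSidedFrom 0 Q Qs z := fun z => by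
    rw [mcProposalKernel, Kernel.map_apply' _ hev _ hB, Kernel.comp_apply' _ _ _ (hev hB),
      Kernel.lintegral_compProd _ _ _ hh]
    rfl
  have hleft : ∫⁻ z in A, mcProposalKernel Q Qs hw s ha z B ∂pi =
      ∫⁻ z, A.indicator 1 z * ∫⁻ x, ∫⁻ k, h (x, k) ∂s x ∂twoSidedFrom 0 Q Qs z ∂pi := by
    rw [← lintegral_indicator hA]
    refine lintegral_congr fun z => ?_
    by_cases hz : z ∈ A <;> simp [hz, hP]
  have hright : ∫⁻ ξ in (fun ξ : (ℤ → Z) × ℤ => ξ.1 0) ⁻¹' A, h ξ ∂extendedLaw pi Q Qs s =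
      ∫⁻ ξ, A.indicator 1 (ξ.1 0) * h ξ ∂extendedLaw pi Q Qs s := by
    rw [← lintegral_indicator (hev hA)]
    refine lintegral_congr fun ξ => ?_
    by_cases hξ : ξ.1 0 ∈ A <;> simp [Set.indicator, hξ]
  refine hleft.trans (Eq.trans ?_ hright.symm)
  have hAh : Measurable fun ξ : (ℤ → Z) × ℤ => A.indicator 1 (ξ.1 0) * h ξ :=
    (h1.comp hev).mul hh
  have hAH : Measurable fun x : ℤ → Z => A.indicator 1 (x 0) * ∫⁻ k, h (x, k) ∂s x :=
    (h1.comp (measurable_pi_apply 0)).mul hH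
  rw [extendedLaw, Measure.lintegral_compProd hAh]
  have e : ∀ x : ℤ → Z, ∫⁻ k, A.indicator 1 (x 0) * h (x, k) ∂s x =
      A.indicator 1 (x 0) * ∫⁻ k, h (x, k) ∂s x := fun x =>
    lintegral_const_mul _ (hh.comp measurable_prodMk_left)
  simp only [e]
  rw [lintegral_twoSidedChain _ _ _ _ hAH]
  exact lintegral_congr fun z => (lintegral_eval_mul_twoSidedFrom 0 Q Qs z h1 hH).symm

end Extended

end MarkovProposal

/-! ### The change of measure and the reversible kernels -/

theorem mainTheorem5 {Z : Type*} [MeasurableSpace Z]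
    (pi ν : Measure Z) [IsProbabilityMeasure pi]
    (Q Qs : Kernel Z Z) [IsMarkovKernel Q] [IsMarkovKernel Qs]
    (w : Z → ℝ≥0) (hw : HasRNDeriv pi ν w)
    (hrev : IsReversibleTriplet ν Q Qs) :
    -- the change of measure between the laws of the two-sided chains
    (∀ k : ℤ,
      HasRNDeriv ((twoSidedChain k pi Q Qs).restrict (posSet w k))
        ((twoSidedChain 0 pi Q Qs).restrict (posSet w k))
        (fun x => w (x k) / w (x 0)) ∧
      (twoSidedChain 0 pi Q Qs).restrict (posSet w k) ≪
        (twoSidedChain k pi Q Qs).restrict (posSet w k)) ∧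
    -- the justification of the Markov chain proposal kernel
    (∀ (s : Kernel (ℤ → Z) ℤ) [IsMarkovKernel s],
      -- `φ` is an involution, and `S` splits `μ` and its image under `φ` as required
      Function.Involutive (invo (Z := Z)) ∧
      invo '' extendedSet w s = extendedSet w s ∧
      (extendedLaw pi Q Qs s).restrict (extendedSet w s)ᶜ ⟂ₘ
        ((extendedLaw pi Q Qs s).map invo).restrict (extendedSet w s)ᶜ ∧
      -- the acceptance ratio is the density on `S` of the image of `μ` under `φ`
      HasRNDeriv (((extendedLaw pi Q Qs s).restrict (extendedSet w s)).map invo)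
        ((extendedLaw pi Q Qs s).restrict (extendedSet w s))
        (acceptRatio w s) ∧
      (extendedLaw pi Q Qs s).restrict (extendedSet w s) ≪
        ((extendedLaw pi Q Qs s).restrict (extendedSet w s)).map invo ∧
      -- the resulting kernels are reversible Markov kernels
      ∀ (a : ℝ≥0 → ℝ≥0) (ha : IsAcceptanceFun a),
        IsMarkovKernel (pairKernel hw.1 s ha) ∧
        (pairKernel hw.1 s ha).IsReversible (extendedLaw pi Q Qs s) ∧
        IsMarkovKernel (mcProposalKernel Q Qs hw.1 s ha) ∧
        (mcProposalKernel Q Qs hw.1 s ha).IsReversible pi) := by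
  obtain ⟨ν', _, hpi, hrev'⟩ := exists_sigmaFinite_reference hw hrev
  have hwm := hw.1
  have hwE : Measurable fun z => (w z : ℝ≥0∞) := measurable_coe_nnreal_ennreal.comp hwm
  have hwk : ∀ k : ℤ, Measurable fun x : ℤ → Z => w (x k) := fun k =>
    hwm.comp (measurable_pi_apply k)
  have hchain : ∀ k, twoSidedChain k pi Q Qs =
      (twoSidedChain 0 ν' Q Qs).withDensity fun x => (w (x k) : ℝ≥0∞) := fun k => by
    rw [hpi, twoSidedChain_withDensity k ν' Q Qs hwE, twoSidedChain_eq_zero hrev' k]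
  refine ⟨fun k => ?_, fun s _ => ?_⟩
  · have hS : MeasurableSet (posSet w k) :=
      measurableSet_lt measurable_const ((hwk 0).min (hwk k))
    rw [hchain k, hchain 0]
    exact ⟨hasRNDeriv_restrict_withDensity (hwk k) (hwk 0) hS (fun x hx => (lt_min_iff.1 hx).1)
        ((hwk k).div (hwk 0)) fun _ _ => rfl,
      restrict_withDensity_absolutelyContinuous (hwk k) hS fun x hx => (lt_min_iff.1 hx).2⟩
  · have hM := map_invo_indexedMeasure (map_shift_twoSidedChain hrev')
    have hS := measurableSet_extendedSet hwm s
    have hm := measurable_pairWeight hwm s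
    have hm' : Measurable fun ξ => pairWeight w s (invo ξ) := hm.comp measurable_invo
    have hlaw := extendedLaw_eq_withDensity hwm (hchain 0) s
    have hlaw' : (extendedLaw pi Q Qs s).map invo =
        (indexedMeasure (twoSidedChain 0 ν' Q Qs)).withDensity
          fun ξ => (pairWeight w s (invo ξ) : ℝ≥0∞) := by
      have hmE : Measurable fun ξ => (pairWeight w s ξ : ℝ≥0∞) :=
        measurable_coe_nnreal_ennreal.comp hm
      rw [hlaw, map_withDensity_of_involutive measurable_invo involutive_invo hM hmE]
    have hmapS : ((extendedLaw pi Q Qs s).restrict (extendedSet w s)).map invo =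
        ((extendedLaw pi Q Qs s).map invo).restrict (extendedSet w s) := by
      rw [Measure.restrict_map measurable_invo hS, invo_preimage_extendedSet]
    refine ⟨involutive_invo, invo_image_extendedSet w s, ?_, ?_, ?_, fun a ha => ?_⟩
    · rw [hlaw', hlaw]
      refine mutuallySingular_restrict_withDensity hm hS.compl fun ξ hξ => ?_
      by_contra! h
      exact hξ (mem_extendedSet_iff.2 ⟨pos_iff_ne_zero.2 h.1, pos_iff_ne_zero.2 h.2⟩)
    · rw [hmapS, hlaw', hlaw]
      exact hasRNDeriv_restrict_withDensity hm' hm hS (fun ξ hξ => (mem_extendedSet_iff.1 hξ).1)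
        (measurable_acceptRatio hwm s) fun ξ hξ => acceptRatio_of_mem hξ
    · rw [hmapS, hlaw', hlaw]
      exact restrict_withDensity_absolutelyContinuous hm' hS
        fun ξ hξ => (mem_extendedSet_iff.1 hξ).2
    · have hpair : IsMarkovKernel (pairKernel hwm s ha) :=
        isMarkovKernel_acceptReject _ _ _ _ fun ξ => ha.le_one _
      have hpairRev : (pairKernel hwm s ha).IsReversible (extendedLaw pi Q Qs s) := by
        rw [hlaw]
        exact acceptReject_isReversible measurable_invo involutive_invo hM hm _
          (acceptance_mul_pairWeight_invo w s ha)
      have hev : Measurable fun ξ : (ℤ → Z) × ℤ => ξ.1 0 :=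
        (measurable_pi_apply 0).comp measurable_fst
      refine ⟨hpair, hpairRev, Kernel.IsMarkovKernel.map _ hev, fun A B hA hB => ?_⟩
      rw [setLIntegral_mcProposalKernel hwm s ha hA hB, setLIntegral_mcProposalKernel hwm s ha hB hA]
      exact hpairRev (hev hA) (hev hB)
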